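/- Let $n,d$ be natural numbers, let $\mathcal G=(\mathcal V,\mathcal E)$ be an undirected simple graph on $\mathcal V=\{1,\dots,n\}$ with $m$ edges, and let $\mathcal A\subseteq\mathcal V^3$ be a set of $w$ triples; $(k,i,j)\in\mathcal A$ stands for the unoriented angle $\theta^k_{ij}\in[0,\pi]$ at vertex $k$ between the directions to $i$ and $j$. Let $\chi\subseteq\mathbb R^{dn}$ be the set of configurations $p=(p_1,\dots,p_n)$, $p_i\in\mathbb R^d$, such that $p_k\ne p_i$ and $p_k\neq p_j$ for all $(k,i,j)\in\mathcal A$; a framework $(\mathcal G,\mathcal A,p)$ is given by some $p\in\chi$. Define $$F_W:\chi\to\mathbb R^{m+w},\qquad F_W(p)=\Big(\big(\|p_i-p_j\|^2\big)_{\{i,j\}\in\mathcal E},\ \big(\cos\theta^k_{ij}(p)\big)_{(k,i,j)\in\mathcal A}\Big),\qquad \cos\theta_{ij}^k(p)=\frac{(p_k-p_i)^\top(p_k-p_j)}{\|p_k-p_i\|\,\|p_k-p_j\|},$$ and let $R_W(p)=\partial F_W/\partial p$ be its Jacobian. * A point $p\in\chi$ is a *regular point* of $F_W$ if $\operatorname{rank}R_W(p)=\max_{q\in\chi}\operatorname{rank}R_W(q)$.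 * The framework is *generalized infinitesimally weakly rigid (GIWR)* if every $v=(v_1,\dots,v_n)\in\mathbb R^{dn}$ with $R_W(p)v=0$ is trivial, i.e. there are $t\in\mathbb R^d$, a skew-symmetric $J\in\mathbb R^{d\times d}$ and $c\in\mathbb R$, with $c=0$ if $\mathcal E\ne\emptyset$, such that $v_i=t+Jp_i+cp_i$ for all $i$. * The framework is *generalized weakly rigid (GWR)* if there is a neighbourhood $B$ of $p$ such that the following holds for all $q\in B\cap\chi$. If $\mathcal E\neq\emptyset$: whenever $\|q_i-q_j\|=\|p_i-p_j\|$ for all $\{i,j\}\in\mathcal E$ and $\cos\theta^k_{ij}(q)=\cos\theta^k_{ij}(p)$ for all $(k,i,j)\in\mathcal A$, then $\|q_i-q_j\|=\|p_i-p_j\|$ for all $i,j\in\mathcal V$. If $\mathcal E=\emptyset$: whenever $\cos\theta^k_{ij}(q)=\cos\theta^k_{ij}(p)$ for all $(k,i,j)\in\mathcal A$, then there is $C>0$ with $\|q_i-q_j\|=C\|p_i-p_j\|$ for all $i,j\in\mathcal V$. **Proposition.** Let $p\in\chi$ and suppose that the affine span of $p_1,\dots,p_n$ is $\mathbb R^d$.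 Then $(\mathcal G,\mathcal A,p)$ is GIWR if and only if $p$ is a regular point of $F_W$ and $(\mathcal G,\mathcal A,p)$ is GWR. -/

import Mathlib

open scoped Topology EuclideanGeometry

noncomputable section

namespace WeakRigidity

/-- Configurations `p = (p_1, …, p_n)` of `n` points in Euclidean `d`-space. -/
abbrev Config (n d : ℕ) : Type := Fin n → EuclideanSpace ℝ (Fin d)

/-- An angle set: a set of triples `(k, i, j)`, each standing for the angle at the vertex `k`
between the directions towards `i` and `j`. -/
abbrev AngleSet (n : ℕ) : Type := Finset (Fin n × Fin n × Fin n)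

variable {n d : ℕ}

/-- The domain `χ` of the weak rigidity function: the configurations for which every assigned angle
is defined, that is, no denominator `‖p_k - p_i‖ ‖p_k - p_j‖` with `(k, i, j) ∈ A` is zero. -/
def domain (A : AngleSet n) : Set (Config n d) :=
  {p | ∀ k i j, (k, i, j) ∈ A → p k ≠ p i ∧ p k ≠ p j}

/-- The squared length `‖p_i - p_j‖²` attached to the undirected pair `{i, j}`. -/
def sqLength (p : Config n d) : Sym2 (Fin n) → ℝ :=
  Sym2.lift ⟨fun i j => ‖p i - p j‖ ^ 2, fun i j => by dsimp only; rw [norm_sub_rev]⟩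

/-- The cosine of the (unoriented) angle at `k` between the directions towards `i` and `j`, for
the triple `(k, i, j)`. -/
def cosAngle (p : Config n d) (a : Fin n × Fin n × Fin n) : ℝ :=
  Real.cos (∠ (p a.2.1) (p a.1) (p a.2.2))

/-- The weak rigidity function `F_W`, with one coordinate for every edge (squared length)
and one for every angle (cosine). -/
def weakRigidityFunction (G : SimpleGraph (Fin n)) (A : AngleSet n) (p : Config n d) :
    G.edgeSet ⊕ A → ℝ :=
  Sum.elim (fun e => sqLength p e.1) (fun a => cosAngle p a.1)

/-- The weak rigidity matrix `R_W(p)`, the Jacobian of `F_W` at `p`, as a linear map. -/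
def weakRigidityMatrix (G : SimpleGraph (Fin n)) (A : AngleSet n) (p : Config n d) :
    Config n d →L[ℝ] (G.edgeSet ⊕ A → ℝ) :=
  fderiv ℝ (weakRigidityFunction G A) p

/-- The rank of `R_W(p)`. -/
def weakRigidityRank (G : SimpleGraph (Fin n)) (A : AngleSet n) (p : Config n d) : ℕ :=
  Module.finrank ℝ (LinearMap.range (weakRigidityMatrix G A p).toLinearMap)

/-- `p` is a regular point of `F_W : χ → ℝ^{m+w}`: the rank of `R_W` at `p` is the maximum of the
ranks of `R_W` over the domain `χ`. -/
def IsRegularPoint (G : SimpleGraph (Fin n)) (A : AngleSet n) (p : Config n d) : Prop :=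
  p ∈ domain A ∧
    IsGreatest {r : ℕ | ∃ q : Config n d, q ∈ domain A ∧ weakRigidityRank G A q = r}
      (weakRigidityRank G A p)

/-- Equality of all assigned angle cosines. If the edge set is empty, this is angle equivalence. -/
def AngleEquivalent (A : AngleSet n) (p q : Config n d) : Prop :=
  ∀ a ∈ A, cosAngle p a = cosAngle q a

/-- Strong equivalence: equal edge lengths and equal angle cosines. -/
def StronglyEquivalent (G : SimpleGraph (Fin n)) (A : AngleSet n) (p q : Config n d) : Prop :=
  (∀ i j, G.Adj i j → ‖p i - p j‖ = ‖q i - q j‖) ∧ ∀ a ∈ A, cosAngle p a = cosAngle q a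

/-- Congruence: all mutual distances agree. -/
def Congruent (p q : Config n d) : Prop :=
  ∀ i j, ‖p i - p j‖ = ‖q i - q j‖

/-- Proportional congruence: all mutual distances agree up to one positive factor. -/
def ProportionallyCongruent (p q : Config n d) : Prop :=
  ∃ C : ℝ, 0 < C ∧ ∀ i j, ‖p i - p j‖ = C * ‖q i - q j‖

/-- Generalized weak rigidity (GWR) of the framework `(G, A, p)`. Frameworks `(G, A, q)` are those
with `q ∈ χ`, so that their angles exist. With at least one edge, strongly equivalent frameworks
near `p` are congruent to it; without edges, angle equivalent frameworks near `p` are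
proportionally congruent to it. -/
def IsGWR (G : SimpleGraph (Fin n)) (A : AngleSet n) (p : Config n d) : Prop :=
  (G.edgeSet ≠ ∅ → ∃ B ∈ 𝓝 p, ∀ q ∈ B, q ∈ domain A →
    StronglyEquivalent G A q p → Congruent q p) ∧
  (G.edgeSet = ∅ → ∃ B ∈ 𝓝 p, ∀ q ∈ B, q ∈ domain A →
    AngleEquivalent A q p → ProportionallyCongruent q p)

/-- An infinitesimal motion of `(G, A, p)`: a vector `v` with `R_W(p) v = 0`. -/
def IsInfinitesimalMotion (G : SimpleGraph (Fin n)) (A : AngleSet n) (p v : Config n d) : Prop :=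
  weakRigidityMatrix G A p v = 0

/-- A trivial motion: a combination of a translation `t`, an infinitesimal rotation (a
skew-symmetric linear map `J`) and, only if there is no edge, a scaling `c` of the whole
configuration. -/
def IsTrivialMotion (G : SimpleGraph (Fin n)) (p v : Config n d) : Prop :=
  ∃ (t : EuclideanSpace ℝ (Fin d))
    (J : EuclideanSpace ℝ (Fin d) →ₗ[ℝ] EuclideanSpace ℝ (Fin d)) (c : ℝ),
    (∀ x y, inner ℝ (J x) y = -inner ℝ x (J y)) ∧
    (G.edgeSet ≠ ∅ → c = 0) ∧
    ∀ i, v i = t + J (p i) + c • p i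

/-- Generalized infinitesimal weak rigidity (GIWR): all infinitesimal motions are trivial. -/
def IsGIWR (G : SimpleGraph (Fin n)) (A : AngleSet n) (p : Config n d) : Prop :=
  ∀ v : Config n d, IsInfinitesimalMotion G A p v → IsTrivialMotion G p v

end WeakRigidity

end

noncomputable section

open Filter Module

/-! Similarities (isometries, if there is an edge) leave `F_W` unchanged, so trivial motions lie in
`ker R_W(q)` at every `q ∈ χ`; GIWR says that they fill the kernel at `p`.

GIWR gives GWR: on a slice through `p` complementary to the trivial motions, `R_W(p)` is injective,
so `p` is isolated in its fibre there. Similarities near the identity carry the slice onto a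
neighbourhood of `p`, so nearby points of the fibre are images of `p`
(`IsGIWR.exists_eq_transform`).

GIWR gives regularity: a competitor `q` may be degenerate and have few trivial motions, so it is
replaced by `q + s • p` with `s` small. The rank of `R_W` does not drop, and for all but finitely
many `s` there are at least as many independent trivial motions as at `p`, which bounds the rank by
that at `p`.

Conversely, at a regular point the rank is locally maximal, so each kernel vector is the velocity of
a curve in the fibre (`ContDiffAt.exists_curve_in_fiber`). By GWR the curve preserves all distances,
up to a common factor if there is no edge. Differentiating, and using that the points span, shows
that the velocity is trivial. -/

theorem LinearMap.exists_reflexive_generalizedInverse {K V W : Type*} [Field K] [AddCommGroup V]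
    [Module K V] [AddCommGroup W] [Module K W] (f : V →ₗ[K] W) :
    ∃ g : W →ₗ[K] V, f ∘ₗ g ∘ₗ f = f ∧ g ∘ₗ f ∘ₗ g = g := by
  -- `g` is a retraction of `W` onto the range of `f` followed by a section of `f` over that range.
  obtain ⟨r, hr⟩ := f.rangeRestrict.exists_rightInverse_of_surjective f.range_rangeRestrict
  obtain ⟨π, hπ⟩ := (LinearMap.range f).subtype.exists_leftInverse_of_injective
    (Submodule.ker_subtype _)
  have hr' (y) : f (r y) = y := congrArg Subtype.val (LinearMap.congr_fun hr y)
  have hπ' (x) : π (f x) = f.rangeRestrict x := LinearMap.congr_fun hπ (f.rangeRestrict x)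
  refine ⟨r ∘ₗ π, ?_, ?_⟩
  · ext x
    simp [hπ', hr']
  · ext x
    have h : π (f (r (π x))) = π x := by
      rw [hr']
      exact LinearMap.congr_fun hπ (π x)
    simp [h]

/-- In a linear pencil `A + s B`, the rank is at least that of `B` for all but finitely many
`s`. -/
theorem LinearMap.finite_setOf_finrank_range_add_smul_lt {K V W : Type*} [Field K]
    [AddCommGroup V] [Module K V] [FiniteDimensional K V] [AddCommGroup W] [Module K W]
    [FiniteDimensional K W] (A B : V →ₗ[K] W) :
    {s : K | finrank K (range (A + s • B)) < finrank K (range B)}.Finite := by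
  obtain ⟨g, hB, hg⟩ := B.exists_reflexive_generalizedInverse
  let T : End K (range g) := (g.rangeRestrict ∘ₗ A).domRestrict (range g)
  refine ((End.finite_hasEigenvalue T).image Neg.neg).subset fun s hs => ?_
  by_contra hne
  have hs' : ¬ End.HasEigenvalue T (-s) := fun h => hne ⟨-s, h, neg_neg s⟩
  rw [Set.mem_ofPred_eq] at hs
  refine hs.not_ge ?_
  -- `g ∘ B` is the identity on `range g`, so a kernel vector of `A + s B` there is an eigenvector
  -- of `T` for `-s`. As `B = B g B`, `range g` has dimension at least the rank of `B`.
  have hinj : Function.Injective ((A + s • B).domRestrict (range g)) := by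
    rw [← LinearMap.ker_eq_bot, LinearMap.ker_eq_bot']
    intro x hx
    by_contra hx0
    refine hs' (End.hasEigenvalue_of_hasEigenvector ⟨End.mem_eigenspace_iff.2 ?_, hx0⟩)
    obtain ⟨y, hy⟩ := x.2
    have h1 : g (B x) = x := by
      rw [← hy]
      exact LinearMap.congr_fun hg y
    have h2 : g ((A + s • B) x) = 0 := by
      have : (A + s • B) x = 0 := hx
      rw [this, map_zero]
    ext
    simp only [LinearMap.add_apply, LinearMap.smul_apply, map_add, map_smul, h1] at h2
    change g (A x) = (-s) • (x : V)
    rw [neg_smul]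
    exact eq_neg_of_add_eq_zero_left h2
  calc finrank K (range B) = finrank K (range (B ∘ₗ g ∘ₗ B)) := by rw [hB]
    _ ≤ finrank K (range (B ∘ₗ g)) :=
        Submodule.finrank_mono (LinearMap.range_comp_le_range B (B ∘ₗ g))
    _ ≤ finrank K (range g) := by
        rw [LinearMap.range_comp]
        exact Submodule.finrank_map_le B (range g)
    _ = finrank K (range ((A + s • B).domRestrict (range g))) :=
        (LinearMap.finrank_range_of_inj hinj).symm
    _ ≤ finrank K (range (A + s • B)) :=
        Submodule.finrank_mono (LinearMap.range_comp_le_range (range g).subtype (A + s • B))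

/-! ### Rank of the derivative and fibres of a map -/

section

variable {V W : Type*} [NormedAddCommGroup V] [NormedSpace ℝ V] [FiniteDimensional ℝ V]
  [NormedAddCommGroup W] [NormedSpace ℝ W]

/-- Lower semicontinuity of the rank. -/
theorem ContinuousAt.eventually_finrank_range_le {X : Type*} [TopologicalSpace X]
    {D : X → V →L[ℝ] W} {x : X} (hD : ContinuousAt D x) :
    ∀ᶠ y in 𝓝 x, finrank ℝ (LinearMap.range (D x).toLinearMap) ≤
      finrank ℝ (LinearMap.range (D y).toLinearMap) := by
  set R := LinearMap.range (D x).toLinearMap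
  let b := finBasis ℝ R
  choose v hv using fun i => (b i).2
  have hli : LinearIndependent ℝ (fun i => D x (v i)) := by
    have h : (fun i => D x (v i)) = R.subtype ∘ b := funext hv
    rw [h]
    exact b.linearIndependent.map' _ (Submodule.ker_subtype _)
  have hc : Tendsto (fun y => fun i => D y (v i)) (𝓝 x) (𝓝 fun i => D x (v i)) :=
    tendsto_pi_nhds.2 fun i => hD.clm_apply continuousAt_const
  -- Linear independence of a finite family is an open condition.
  filter_upwards [hc.eventually hli.eventually] with y hy
  have hli' : LinearIndependent ℝ
      (fun i => (⟨D y (v i), v i, rfl⟩ : LinearMap.range (D y).toLinearMap)) :=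
    LinearIndependent.of_comp (LinearMap.range (D y).toLinearMap).subtype hy
  simpa using hli'.fintype_card_le_finrank

/-- On a slice complementary to the kernel of the derivative, a map is locally injective. -/
theorem HasFDerivAt.eventually_eq_of_disjoint_ker {F : V → W} {D : V →L[ℝ] W} {p : V}
    (hF : HasFDerivAt F D p) {S : Submodule ℝ V} (hS : Disjoint S (LinearMap.ker D.toLinearMap)) :
    ∀ᶠ x in 𝓝 p, x - p ∈ S → F x = F p → x = p := by
  have hker : LinearMap.ker (D.toLinearMap.domRestrict S) = ⊥ := by
    rw [LinearMap.ker_eq_bot']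
    intro x hx
    exact Subtype.ext (Submodule.disjoint_def.1 hS x x.2 hx)
  obtain ⟨K, hK, hanti⟩ := (D.toLinearMap.domRestrict S).exists_antilipschitzWith hker
  have hK' : (0 : ℝ) < K := hK
  -- With this constant the linearisation error forces `‖x - p‖ ≤ ‖x - p‖ / 2`.
  have ho := (hasFDerivAt_iff_isLittleO.1 hF).def (c := (2 * (K : ℝ))⁻¹) (by positivity)
  filter_upwards [ho] with x hx hxS hFx
  have h1 : ‖x - p‖ ≤ K * ‖D (x - p)‖ := by
    have h := hanti.le_mul_norm_sub (⟨x - p, hxS⟩ : S) 0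
    rwa [map_zero, add_zero, add_zero, norm_neg, norm_neg] at h
  rw [hFx, sub_self, zero_sub, norm_neg] at hx
  have h2 : ‖x - p‖ ≤ K * ((2 * (K : ℝ))⁻¹ * ‖x - p‖) :=
    h1.trans (mul_le_mul_of_nonneg_left hx hK'.le)
  have h3 : K * ((2 * (K : ℝ))⁻¹ * ‖x - p‖) = ‖x - p‖ / 2 := by field_simp
  rw [h3] at h2
  have h4 : ‖x - p‖ = 0 := le_antisymm (by linarith) (norm_nonneg _)
  exact sub_eq_zero.1 (norm_eq_zero.1 h4)

/-- At a point where the rank of the derivative is locally maximal, every vector in the kernel of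
the derivative is the velocity of a curve in the fibre. -/
theorem ContDiffAt.exists_curve_in_fiber [FiniteDimensional ℝ W] {F : V → W} {p : V}
    (hF : ContDiffAt ℝ 1 F p)
    (hrank : ∀ᶠ q in 𝓝 p, finrank ℝ (LinearMap.range (fderiv ℝ F q).toLinearMap) ≤
      finrank ℝ (LinearMap.range (fderiv ℝ F p).toLinearMap))
    {v : V} (hv : fderiv ℝ F p v = 0) :
    ∃ γ : ℝ → V, γ 0 = p ∧ HasDerivAt γ v 0 ∧ ∀ᶠ s in 𝓝 0, F (γ s) = F p := by
  set D := fderiv ℝ F p with hDdef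
  obtain ⟨g₀, hD₀, hg₀⟩ := D.toLinearMap.exists_reflexive_generalizedInverse
  let g : W →L[ℝ] V := g₀.toContinuousLinearMap
  have hDgD (x) : D (g (D x)) = D x := LinearMap.congr_fun hD₀ x
  have hgDg (y) : g (D (g y)) = g y := LinearMap.congr_fun hg₀ y
  -- `Ψ` has derivative the identity at `p` and satisfies `g D Ψ = g F`. Pulling back the line `Ψ p
  -- + s v` with `D v = 0` therefore keeps `g ∘ F` constant.
  let Ψ : V → V := fun q => g (F q) + (q - g (D q))
  have hΨ : ContDiffAt ℝ 1 Ψ p := by fun_prop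
  have hFd : HasFDerivAt F D p := (hF.differentiableAt one_ne_zero).hasFDerivAt
  have hΨ' : HasFDerivAt Ψ (ContinuousLinearEquiv.refl ℝ V : V →L[ℝ] V) p := by
    have h := (g.hasFDerivAt.comp p hFd).add
      ((hasFDerivAt_id p).sub (g.comp D).hasFDerivAt)
    have hid : (ContinuousLinearEquiv.refl ℝ V : V →L[ℝ] V) =
        g.comp D + (ContinuousLinearMap.id ℝ V - g.comp D) := by
      ext x
      simp
    rw [hid]
    exact h
  set θ := hΨ.localInverse hΨ' one_ne_zero
  have hθ : ContDiffAt ℝ 1 θ (Ψ p) := hΨ.to_localInverse hΨ' one_ne_zero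
  have hθp : θ (Ψ p) = p := hΨ.localInverse_apply_image hΨ' one_ne_zero
  have hθ' : HasStrictFDerivAt θ _ (Ψ p) := (hΨ.hasStrictFDerivAt' hΨ' one_ne_zero).to_localInverse
  have hinv : ∀ᶠ y in 𝓝 (Ψ p), Ψ (θ y) = y :=
    (hΨ.hasStrictFDerivAt' hΨ' one_ne_zero).eventually_right_inverse
  let ℓ : ℝ → V := fun s => Ψ p + s • v
  have hℓ0 : ℓ 0 = Ψ p := by simp [ℓ]
  have hℓ : ContDiff ℝ 1 ℓ := by fun_prop
  have hℓ' : HasDerivAt ℓ v 0 := by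
    simpa [ℓ] using ((hasDerivAt_id (0 : ℝ)).smul_const v).const_add (Ψ p)
  have hℓt : Tendsto ℓ (𝓝 0) (𝓝 (Ψ p)) := hℓ0 ▸ hℓ.continuous.tendsto 0
  let γ : ℝ → V := θ ∘ ℓ
  have hγ0 : γ 0 = p := by simp [γ, hℓ0, hθp]
  have hγ : ContDiffAt ℝ 1 γ 0 := ContDiffAt.comp 0 (hℓ0 ▸ hθ) hℓ.contDiffAt
  have hγt : Tendsto γ (𝓝 0) (𝓝 p) := hγ0 ▸ hγ.continuousAt
  refine ⟨γ, hγ0, ?_, ?_⟩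
  · have h := HasFDerivAt.comp_hasDerivAt (0 : ℝ) (hℓ0 ▸ hθ'.hasFDerivAt) hℓ'
    simpa using h
  have hgF : ∀ᶠ s in 𝓝 (0 : ℝ), g (F (γ s)) = g (F p) := by
    filter_upwards [hℓt.eventually hinv] with s hs
    have h := congrArg (fun x => g (D x)) hs
    simpa [Ψ, ℓ, γ, hDgD, hgDg, hv] using h
  -- Near `p`, `rank (g ∘ DF_q) ≥ rank (g ∘ D) ≥ rank D ≥ rank DF_q`, so `g` loses nothing on the
  -- range of `DF_q`. Hence constancy of `g ∘ F` along `γ` gives constancy of `F`.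
  have hker : ∀ᶠ q in 𝓝 p, ∀ x, g (fderiv ℝ F q x) = 0 → fderiv ℝ F q x = 0 := by
    have hc : ContinuousAt (fun q => g.comp (fderiv ℝ F q)) p :=
      continuousAt_const.clm_comp (hF.continuousAt_fderiv one_ne_zero)
    filter_upwards [hrank, hc.eventually_finrank_range_le] with q h1 h2 x hx
    rw [← hDdef] at h2
    have h3 : finrank ℝ (LinearMap.range D.toLinearMap) ≤
        finrank ℝ (LinearMap.range (g.comp D).toLinearMap) := by
      have : LinearMap.range D.toLinearMap =
          (LinearMap.range (g.comp D).toLinearMap).map D.toLinearMap := by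
        rw [← LinearMap.range_comp]
        exact congrArg LinearMap.range hD₀.symm
      rw [this]
      exact Submodule.finrank_map_le _ _
    have h4 := (fderiv ℝ F q).toLinearMap.finrank_range_add_finrank_ker
    have h5 := (g.comp (fderiv ℝ F q)).toLinearMap.finrank_range_add_finrank_ker
    have h6 : LinearMap.ker (fderiv ℝ F q).toLinearMap ≤
        LinearMap.ker (g.comp (fderiv ℝ F q)).toLinearMap :=
      LinearMap.ker_le_ker_comp _ g₀
    have h7 := Submodule.eq_of_le_of_finrank_le h6 (by omega)
    have h8 : x ∈ LinearMap.ker (g.comp (fderiv ℝ F q)).toLinearMap := hx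
    rw [← h7] at h8
    exact h8
  have hdiff : ∀ᶠ s in 𝓝 (0 : ℝ), HasDerivAt (F ∘ γ) 0 s := by
    have hFev : ∀ᶠ q in 𝓝 p, DifferentiableAt ℝ F q :=
      (hF.eventually (by simp)).mono fun q hq => hq.differentiableAt one_ne_zero
    have hγev : ∀ᶠ s in 𝓝 (0 : ℝ), DifferentiableAt ℝ γ s :=
      (hγ.eventually (by simp)).mono fun q hq => hq.differentiableAt one_ne_zero
    filter_upwards [hγt.eventually hFev, hγev, hγt.eventually hker,
      hgF.eventually_nhds] with s h1 h2 h3 h4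
    have h5 := h1.hasFDerivAt.comp_hasDerivAt s h2.hasDerivAt
    have h6 : HasDerivAt (fun s => g (F (γ s))) (g (fderiv ℝ F (γ s) (deriv γ s))) s :=
      g.hasFDerivAt.comp_hasDerivAt s h5
    have h7 : HasDerivAt (fun s => g (F (γ s))) 0 s :=
      (hasDerivAt_const s (g (F p))).congr_of_eventuallyEq h4
    rw [← h3 _ (h6.unique h7)]
    exact h5
  obtain ⟨ε, hε, hball⟩ := Metric.eventually_nhds_iff_ball.1 hdiff
  filter_upwards [Metric.ball_mem_nhds (0 : ℝ) hε] with s hs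
  have := Metric.isOpen_ball.is_const_of_deriv_eq_zero (convex_ball (0 : ℝ) ε).isPreconnected
    (f := F ∘ γ) (fun t ht => (hball t ht).differentiableAt.differentiableWithinAt)
    (fun t ht => (hball t ht).deriv) hs (Metric.mem_ball_self hε)
  simpa [hγ0] using this

end

/-- The adjoint of `J` is `-J`, so `exp J` is unitary. This integrates infinitesimal rotations to
rotations. -/
theorem ContinuousLinearMap.norm_exp_apply_of_skew {H : Type*} [NormedAddCommGroup H]
    [InnerProductSpace ℝ H] [CompleteSpace H] {J : H →L[ℝ] H}
    (hJ : ∀ x y, inner ℝ (J x) y = -inner ℝ x (J y)) (x : H) :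
    ‖NormedSpace.exp J x‖ = ‖x‖ := by
  have h : J ∈ skewAdjoint (H →L[ℝ] H) := by
    rw [skewAdjoint.mem_iff, ContinuousLinearMap.star_eq_adjoint]
    symm
    rw [ContinuousLinearMap.eq_adjoint_iff]
    intro x y
    rw [neg_apply, inner_neg_left, hJ, neg_neg]
  let _ : NormedAlgebra ℚ (H →L[ℝ] H) := NormedAlgebra.restrictScalars ℚ ℝ _
  have h' := NormedSpace.exp_mem_unitary_of_mem_skewAdjoint h
  exact ContinuousLinearMap.norm_map_of_mem_unitary h' x

/-! ### The weak rigidity function and its invariance under similarities -/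

namespace WeakRigidity

variable {n d : ℕ}

theorem isOpen_domain (A : AngleSet n) : IsOpen (domain A : Set (Config n d)) := by
  have h : (domain A : Set (Config n d)) =
      ⋂ a ∈ A, {p : Config n d | p a.1 ≠ p a.2.1 ∧ p a.1 ≠ p a.2.2} := by
    ext p
    simp [domain]
  rw [h]
  refine A.finite_toSet.isOpen_biInter fun a _ => ?_
  have hne (i j : Fin n) : IsOpen {p : Config n d | p i ≠ p j} :=
    isOpen_ne_fun (by fun_prop) (by fun_prop)
  exact (hne _ _).inter (hne _ _)

theorem contDiffAt_cosAngle {p : Config n d} {a : Fin n × Fin n × Fin n}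
    (h₁ : p a.1 ≠ p a.2.1) (h₂ : p a.1 ≠ p a.2.2) :
    ContDiffAt ℝ 1 (fun q : Config n d => cosAngle q a) p := by
  simp only [cosAngle, EuclideanGeometry.angle, InnerProductGeometry.cos_angle, vsub_eq_sub]
  have h (i : Fin n) : ContDiffAt ℝ 1 (fun q : Config n d => q i - q a.1) p :=
    by fun_prop
  have h₁' : p a.2.1 - p a.1 ≠ 0 := sub_ne_zero.2 h₁.symm
  have h₂' : p a.2.2 - p a.1 ≠ 0 := sub_ne_zero.2 h₂.symm
  exact ((h _).inner ℝ (h _)).div (((h _).norm ℝ h₁').mul ((h _).norm ℝ h₂'))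
    (mul_ne_zero (norm_ne_zero_iff.2 h₁') (norm_ne_zero_iff.2 h₂'))

theorem contDiffAt_weakRigidityFunction (G : SimpleGraph (Fin n)) [Fintype G.edgeSet] {A : AngleSet n}
    {p : Config n d} (hp : p ∈ domain A) : ContDiffAt ℝ 1 (weakRigidityFunction G A) p := by
  rw [contDiffAt_pi]
  rintro (⟨e, -⟩ | ⟨⟨k, i, j⟩, ha⟩)
  · induction e with
    | _ i j =>
      exact (show ContDiffAt ℝ 1 (fun q : Config n d => q i - q j) p by fun_prop).norm_sq ℝ
  · exact contDiffAt_cosAngle (hp k i j ha).1 (hp k i j ha).2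

theorem weakRigidityFunction_eq_iff {G : SimpleGraph (Fin n)} {A : AngleSet n}
    {p q : Config n d} :
    weakRigidityFunction G A p = weakRigidityFunction G A q ↔ StronglyEquivalent G A p q := by
  constructor
  · intro h
    refine ⟨fun i j hij => ?_, fun a ha => congrFun h (.inr ⟨a, ha⟩)⟩
    exact (sq_eq_sq₀ (norm_nonneg _) (norm_nonneg _)).1 (congrFun h (.inl ⟨s(i, j), hij⟩))
  · rintro ⟨h₁, h₂⟩
    funext x
    rcases x with ⟨e, he⟩ | ⟨a, ha⟩
    · induction e with
      | _ i j => exact congrArg (· ^ 2) (h₁ i j he)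
    · exact h₂ a ha

/-- The parameters of an affine velocity field: a translation vector, a linear operator, and a
scaling factor. -/
abbrev MotionParams (d : ℕ) : Type :=
  EuclideanSpace ℝ (Fin d) × (EuclideanSpace ℝ (Fin d) →L[ℝ] EuclideanSpace ℝ (Fin d)) × ℝ

/-- The parameters of trivial motions: a translation vector, a skew-adjoint operator, and a
scaling factor, which vanishes as soon as there is an edge. -/
def trivialParams (G : SimpleGraph (Fin n)) (d : ℕ) :
    Submodule ℝ (MotionParams d) where
  carrier := {u | (∀ x y, inner ℝ (u.2.1 x) y = -inner ℝ x (u.2.1 y)) ∧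
    (G.edgeSet ≠ ∅ → u.2.2 = 0)}
  add_mem' := by
    rintro u v ⟨hu, hu'⟩ ⟨hv, hv'⟩
    refine ⟨fun x y => ?_, fun h => by simp [hu' h, hv' h]⟩
    simp [inner_add_left, inner_add_right, hu x y, hv x y]
    ring
  zero_mem' := by simp
  smul_mem' := by
    rintro c u ⟨hu, hu'⟩
    refine ⟨fun x y => ?_, fun h => by simp [hu' h]⟩
    simp [inner_smul_left, inner_smul_right, hu x y]

/-- The velocity field at the configuration `q` of a trivial motion with given parameters. -/
def trivialVelocity (q : Config n d) :
    MotionParams d →ₗ[ℝ] Config n d where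
  toFun u := fun i => u.1 + u.2.1 (q i) + u.2.2 • q i
  map_add' u v := by
    funext i
    simp [add_smul]
    abel
  map_smul' c u := by
    funext i
    simp [mul_smul]

/-- The space of trivial motions of a configuration. -/
def trivialMotions (G : SimpleGraph (Fin n)) (q : Config n d) : Submodule ℝ (Config n d) :=
  (trivialParams G d).map (trivialVelocity q)

theorem mem_trivialMotions {G : SimpleGraph (Fin n)} {q v : Config n d} :
    v ∈ trivialMotions G q ↔ IsTrivialMotion G q v := by
  constructor
  · rintro ⟨⟨t, J, c⟩, ⟨hJ, hc⟩, rfl⟩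
    exact ⟨t, J, c, hJ, hc, fun i => rfl⟩
  · rintro ⟨t, J, c, hJ, hc, hv⟩
    exact ⟨(t, J.toContinuousLinearMap, c), ⟨hJ, hc⟩, (funext hv).symm⟩

/-- The similarity transformation with parameters `u`, applied to the configuration `x`. -/
def transform (u : MotionParams d) (x : Config n d) :
    Config n d :=
  fun i => u.1 + Real.exp u.2.2 • NormedSpace.exp u.2.1 (x i)

/-- Both exponentials have derivative the identity at `0`, so trivial motions are the infinitesimal
action of the similarities. Strictness is what local surjectivity requires later. -/
theorem hasStrictFDerivAt_transform (q : Config n d) :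
    ∃ D : (MotionParams d × Config n d) →L[ℝ]
          Config n d,
      (∀ u x, D (u, x) = trivialVelocity q u + x) ∧
      HasStrictFDerivAt (fun z : MotionParams d × Config n d =>
          transform z.1 z.2) D (0, q) := by
  have key (i : Fin n) : ∃ D : (MotionParams d × Config n d) →L[ℝ]
          EuclideanSpace ℝ (Fin d),
      (∀ u x, D (u, x) = (trivialVelocity q u + x) i) ∧
      HasStrictFDerivAt (fun z : MotionParams d × Config n d =>
          transform z.1 z.2 i) D (0, q) := by
    have h₁ := (hasStrictFDerivAt_fst (𝕜 := ℝ) (p := ((0 : MotionParams d), q)))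
    have hJ : HasStrictFDerivAt (NormedSpace.exp : (EuclideanSpace ℝ (Fin d) →L[ℝ]
        EuclideanSpace ℝ (Fin d)) → _) 1 0 := hasStrictFDerivAt_exp_zero (𝕂 := ℝ)
    have hc : HasStrictDerivAt Real.exp 1 0 := by
      simpa using Real.hasStrictDerivAt_exp 0
    have hx := (hasStrictFDerivAt_apply (𝕜 := ℝ)
      (F' := fun _ : Fin n => EuclideanSpace ℝ (Fin d)) i q).comp (0, q) (hasStrictFDerivAt_snd
      (𝕜 := ℝ) (p := ((0 : MotionParams d), q)))
    have h₂ := HasStrictFDerivAt.comp (0, q) hJ h₁.snd.fst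
    have h₃ := HasStrictDerivAt.comp_hasStrictFDerivAt (0, q) hc h₁.snd.snd
    refine ⟨_, fun u x => ?_, h₁.fst.add (h₃.smul (h₂.clm_apply hx))⟩
    simp [trivialVelocity]
    abel
  choose D hD hD' using key
  exact ⟨ContinuousLinearMap.pi D, fun u x => funext fun i => hD i u x,
    hasStrictFDerivAt_pi.2 hD'⟩

theorem transform_zero (x : Config n d) : transform 0 x = x := by
  funext i
  simp [transform]

variable {G : SimpleGraph (Fin n)}

theorem norm_transform_sub {u} (hu : u ∈ trivialParams G d) (x : Config n d) (i j : Fin n) :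
    ‖transform u x i - transform u x j‖ = Real.exp u.2.2 * ‖x i - x j‖ := by
  rw [transform, transform, add_sub_add_left_eq_sub, ← smul_sub, ← map_sub, norm_smul,
    ContinuousLinearMap.norm_exp_apply_of_skew hu.1, Real.norm_eq_abs, Real.abs_exp]

theorem cosAngle_transform {u} (hu : u ∈ trivialParams G d) (x : Config n d)
    (a : Fin n × Fin n × Fin n) : cosAngle (transform u x) a = cosAngle x a := by
  let U : EuclideanSpace ℝ (Fin d) →ₗᵢ[ℝ] EuclideanSpace ℝ (Fin d) :=
    ⟨(NormedSpace.exp u.2.1).toLinearMap, ContinuousLinearMap.norm_exp_apply_of_skew hu.1⟩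
  have h (i j : Fin n) : transform u x i - transform u x j = Real.exp u.2.2 • U (x i - x j) := by
    rw [transform, transform, add_sub_add_left_eq_sub, ← smul_sub, ← map_sub]
    rfl
  simp only [cosAngle, EuclideanGeometry.angle, vsub_eq_sub, h]
  rw [InnerProductGeometry.angle_smul_smul (Real.exp_ne_zero _), U.angle_map]

theorem weakRigidityFunction_transform {A : AngleSet n} {u} (hu : u ∈ trivialParams G d)
    (x : Config n d) :
    weakRigidityFunction G A (transform u x) = weakRigidityFunction G A x := by
  refine weakRigidityFunction_eq_iff.2 ⟨fun i j hij => ?_, fun a _ => cosAngle_transform hu x a⟩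
  have hc : u.2.2 = 0 := hu.2 (Set.nonempty_iff_ne_empty.1 ⟨s(i, j), hij⟩)
  rw [norm_transform_sub hu, hc, Real.exp_zero, one_mul]

/-- Differentiate at `s = 0` the constant function `s ↦ F_W (transform (s • u) q)`. -/
theorem trivialMotions_le_ker [Fintype G.edgeSet] {A : AngleSet n} {q : Config n d} (hq : q ∈ domain A) :
    trivialMotions G q ≤ LinearMap.ker (weakRigidityMatrix G A q).toLinearMap := by
  rintro _ ⟨u, hu, rfl⟩
  obtain ⟨D, hD, hΦ⟩ := hasStrictFDerivAt_transform q
  have hcurve : HasDerivAt (fun s : ℝ => (s • u, q)) (u, (0 : Config n d)) 0 := by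
    simpa using ((hasDerivAt_id (0 : ℝ)).smul_const u).prodMk (hasDerivAt_const (0 : ℝ) q)
  have hΦ' := hΦ.hasFDerivAt
  rw [← zero_smul ℝ u] at hΦ'
  have h₁ : HasDerivAt (fun s : ℝ => transform (s • u) q) (D (u, 0)) 0 :=
    HasFDerivAt.comp_hasDerivAt (0 : ℝ) (l := fun z : MotionParams d × Config n d =>
        transform z.1 z.2) hΦ' hcurve
  have h₀ : transform ((0 : ℝ) • u) q = q :=
    (congrArg (transform · q) (zero_smul ℝ u)).trans (transform_zero q)
  have hF := ((contDiffAt_weakRigidityFunction G hq).differentiableAt one_ne_zero).hasFDerivAt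
  have h₂ : HasDerivAt (fun s : ℝ => weakRigidityFunction G A (transform (s • u) q))
      (weakRigidityMatrix G A q (D (u, 0))) 0 :=
    HasFDerivAt.comp_hasDerivAt (0 : ℝ) (l := weakRigidityFunction G A) (by rwa [h₀]) h₁
  have h₃ : (fun s : ℝ => weakRigidityFunction G A (transform (s • u) q)) =
      fun _ => weakRigidityFunction G A q :=
    funext fun s => weakRigidityFunction_transform (Submodule.smul_mem _ s hu) q
  rw [h₃, hD, add_zero] at h₂
  exact h₂.unique (hasDerivAt_const _ _)

end WeakRigidity

/-- A velocity field on an affinely spanning family that infinitesimally preserves all mutual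
distances is the restriction of an infinitesimal isometry. -/
theorem exists_skew_of_inner_sub_eq_zero {ι E : Type*} [Fintype ι] [NormedAddCommGroup E]
    [InnerProductSpace ℝ E] {p v : ι → E} (hspan : affineSpan ℝ (Set.range p) = ⊤)
    (h : ∀ i j, inner ℝ (p i - p j) (v i - v j) = 0) :
    ∃ (t : E) (J : E →ₗ[ℝ] E), (∀ x y, inner ℝ (J x) y = -inner ℝ x (J y)) ∧
      ∀ i, v i = t + J (p i) := by
  have hne : (Set.range p).Nonempty := by
    rw [← affineSpan_nonempty ℝ, hspan]
    exact ⟨0, trivial⟩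
  obtain ⟨_, o, rfl⟩ := id hne
  let U := Fintype.linearCombination ℝ (fun i => p i - p o)
  let X := Fintype.linearCombination ℝ (fun i => v i - v o)
  have hU : LinearMap.range U = ⊤ := by
    rw [Fintype.range_linearCombination]
    have h₁ := (AffineSubspace.affineSpan_eq_top_iff_vectorSpan_eq_top_of_nonempty
      ℝ E E hne).1 hspan
    rw [vectorSpan_range_eq_span_range_vsub_right ℝ p o] at h₁
    exact h₁
  have hskew (a b : ι → ℝ) : inner ℝ (X a) (U b) = -inner ℝ (U a) (X b) := by
    -- Polarisation of the hypothesis for the pairs `(i, j)`, `(i, o)`, `(j, o)`.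
    have hij (i j : ι) : inner ℝ (v i - v o) (p j - p o) = -inner ℝ (p i - p o) (v j - v o) := by
      have h₁ := h i j
      have h₂ := h i o
      have h₃ := h j o
      rw [← sub_sub_sub_cancel_right (p i) (p j) (p o),
        ← sub_sub_sub_cancel_right (v i) (v j) (v o), inner_sub_left,
        inner_sub_right _ (v i - v o), inner_sub_right _ (v i - v o), h₂, h₃] at h₁
      rw [real_inner_comm]
      linarith
    simp only [X, U, Fintype.linearCombination_apply, sum_inner, inner_sum, inner_smul_left,
      inner_smul_right, hij, mul_neg, Finset.sum_neg_distrib]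
  -- The rule `U a ↦ X a` is well defined: since the points span, `X a = U b` for some `b`, and `⟪X
  -- a, U b⟫ = -⟪U a, X b⟫ = 0`.
  have hker {a : ι → ℝ} (ha : U a = 0) : X a = 0 := by
    obtain ⟨b, hb⟩ : X a ∈ LinearMap.range U := hU ▸ trivial
    rw [← inner_self_eq_zero (𝕜 := ℝ)]
    nth_rw 2 [← hb]
    rw [hskew, ha, inner_zero_left, neg_zero]
  obtain ⟨r, hr⟩ := U.exists_rightInverse_of_surjective hU
  have hr' (x : E) : U (r x) = x := LinearMap.congr_fun hr x
  have hJ (a : ι → ℝ) : X (r (U a)) = X a := by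
    rw [← sub_eq_zero, ← map_sub]
    exact hker (by rw [map_sub, hr', sub_self])
  refine ⟨v o - X (r (p o)), X ∘ₗ r, fun x y => ?_, fun i => ?_⟩
  · have := hskew (r x) (r y)
    rwa [hr', hr'] at this
  · classical
    have h₁ := hJ (Pi.single i 1)
    simp only [U, X, Fintype.linearCombination_apply_single, one_smul] at h₁
    simp only [LinearMap.comp_apply, X]
    rw [map_sub, map_sub] at h₁
    rw [sub_add_eq_add_sub, add_sub_assoc, h₁]
    abel

/-- A local surjectivity statement: if the derivative of `Φ` at `(0, p)` maps `P × S` onto the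
target, then every point near `Φ (0, p)` is of the form `Φ (u, x)` with `u ∈ P` and `x` near `p` in
the affine subspace `p + S`. -/
theorem HasStrictFDerivAt.eventually_exists_of_surjective {E V W : Type*} [NormedAddCommGroup E]
    [NormedSpace ℝ E] [FiniteDimensional ℝ E] [NormedAddCommGroup V] [NormedSpace ℝ V]
    [FiniteDimensional ℝ V] [NormedAddCommGroup W] [NormedSpace ℝ W] [FiniteDimensional ℝ W]
    {Φ : E × V → W} {D : E × V →L[ℝ] W} {p : V} (hΦ : HasStrictFDerivAt Φ D (0, p))
    {P : Submodule ℝ E} {S : Submodule ℝ V} (hsurj : ∀ w, ∃ u ∈ P, ∃ s ∈ S, D (u, s) = w)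
    {Q : V → Prop} (hQ : ∀ᶠ x in 𝓝 p, Q x) :
    ∀ᶠ q in 𝓝 (Φ (0, p)), ∃ u ∈ P, ∃ x, x - p ∈ S ∧ Q x ∧ Φ (u, x) = q := by
  let incl : P × S →L[ℝ] E × V := P.subtypeL.prodMap S.subtypeL
  let shift : P × S → E × V := fun z => (0, p) + incl z
  have h₀ : shift 0 = (0, p) := by simp [shift]
  have hshift : HasStrictFDerivAt shift incl 0 := incl.hasStrictFDerivAt.const_add (0, p)
  have hΨ : HasStrictFDerivAt (Φ ∘ shift) (D.comp incl) 0 :=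
    HasStrictFDerivAt.comp 0 (by rwa [h₀]) hshift
  have hrange : LinearMap.range (D.comp incl).toLinearMap = ⊤ := by
    rw [LinearMap.range_eq_top]
    intro w
    obtain ⟨u, hu, s, hs, hw⟩ := hsurj w
    exact ⟨(⟨u, hu⟩, ⟨s, hs⟩), hw⟩
  have : CompleteSpace P := FiniteDimensional.complete ℝ P
  have : CompleteSpace S := FiniteDimensional.complete ℝ S
  have : CompleteSpace W := FiniteDimensional.complete ℝ W
  -- A strictly differentiable map with surjective derivative is open at the point.
  have hmap := hΨ.map_nhds_eq_of_surj hrange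
  have hc : Tendsto (fun z => (shift z).2) (𝓝 0) (𝓝 p) := by
    have h₁ := (continuous_snd.tendsto (shift 0)).comp hshift.continuousAt
    rw [h₀] at h₁
    exact h₁
  have himg := image_mem_map (m := Φ ∘ shift) (hc.eventually hQ)
  rw [hmap, Function.comp_apply, h₀] at himg
  filter_upwards [himg]
  rintro _ ⟨⟨u, s⟩, hz, rfl⟩
  refine ⟨u, u.2, p + s, by simp, hz, ?_⟩
  simp [shift, incl]

/-! ### The two implications -/

namespace WeakRigidity

variable {n d : ℕ} {G : SimpleGraph (Fin n)} {A : AngleSet n} {p : Config n d}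

theorem IsGIWR.exists_eq_transform [Fintype G.edgeSet] (hp : p ∈ domain A) (h : IsGIWR G A p) :
    ∀ᶠ q in 𝓝 p, weakRigidityFunction G A q = weakRigidityFunction G A p →
      ∃ u ∈ trivialParams G d, q = transform u p := by
  obtain ⟨S, hS⟩ := (trivialMotions G p).exists_isCompl
  have hF := ((contDiffAt_weakRigidityFunction G hp).differentiableAt one_ne_zero).hasFDerivAt
  have hdisj : Disjoint S (LinearMap.ker (weakRigidityMatrix G A p).toLinearMap) :=
    hS.disjoint.symm.mono_right fun v hv => mem_trivialMotions.2 (h v hv)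
  have hslice := hF.eventually_eq_of_disjoint_ker hdisj
  obtain ⟨D, hD, hΦ⟩ := hasStrictFDerivAt_transform p
  have hsurj (w : Config n d) : ∃ u ∈ trivialParams G d, ∃ s ∈ S, D (u, s) = w := by
    obtain ⟨_, ⟨u, hu, rfl⟩, s, hs, rfl⟩ := Submodule.mem_sup.1
      (hS.sup_eq_top ▸ trivial : w ∈ trivialMotions G p ⊔ S)
    exact ⟨u, hu, s, hs, hD u s⟩
  have hev := hΦ.eventually_exists_of_surjective hsurj hslice
  rw [transform_zero] at hev
  filter_upwards [hev]
  rintro _ ⟨u, hu, x, hx, hxp, rfl⟩ hq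
  exact ⟨u, hu, congrArg (transform u)
    (hxp hx ((weakRigidityFunction_transform hu x).symm.trans hq))⟩

theorem IsGIWR.isGWR (hp : p ∈ domain A) (h : IsGIWR G A p) : IsGWR G A p := by
  have := Fintype.ofFinite G.edgeSet
  have key := h.exists_eq_transform hp
  constructor
  · intro hE
    refine ⟨_, key, fun q hq _ hqp => ?_⟩
    obtain ⟨u, hu, rfl⟩ := hq (weakRigidityFunction_eq_iff.2 hqp)
    intro i j
    rw [norm_transform_sub hu, hu.2 hE, Real.exp_zero, one_mul]
  · intro hE
    refine ⟨_, key, fun q hq _ hqp => ?_⟩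
    have hlen (i j) (hij : G.Adj i j) : ‖q i - q j‖ = ‖p i - p j‖ :=
      (Set.eq_empty_iff_forall_notMem.1 hE s(i, j) hij).elim
    obtain ⟨u, hu, rfl⟩ := hq (weakRigidityFunction_eq_iff.2 ⟨hlen, hqp⟩)
    exact ⟨_, Real.exp_pos _, norm_transform_sub hu p⟩

theorem eventually_weakRigidityRank_le [Fintype G.edgeSet] (hp : p ∈ domain A) :
    ∀ᶠ q in 𝓝 p, weakRigidityRank G A p ≤ weakRigidityRank G A q :=
  ContinuousAt.eventually_finrank_range_le (V := Config n d) (W := G.edgeSet ⊕ A → ℝ)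
    ((contDiffAt_weakRigidityFunction G hp).continuousAt_fderiv one_ne_zero)

theorem weakRigidityRank_add_finrank_ker (q : Config n d) :
    weakRigidityRank G A q + finrank ℝ (LinearMap.ker (weakRigidityMatrix G A q).toLinearMap) =
      finrank ℝ (Config n d) :=
  (weakRigidityMatrix G A q).toLinearMap.finrank_range_add_finrank_ker

theorem IsGIWR.isRegularPoint (hp : p ∈ domain A) (h : IsGIWR G A p) : IsRegularPoint G A p := by
  have := Fintype.ofFinite G.edgeSet
  refine ⟨hp, ⟨p, hp, rfl⟩, ?_⟩
  rintro _ ⟨q, hq, rfl⟩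
  let L (x : Config n d) := (trivialVelocity x).domRestrict (trivialParams G d)
  have hL (x) : LinearMap.range (L x) = trivialMotions G x := LinearMap.range_domRestrict _ _
  have hfin := LinearMap.finite_setOf_finrank_range_add_smul_lt (K := ℝ) (V := trivialParams G d)
    (W := Config n d) (L q) (L p)
  have hline : Tendsto (fun s : ℝ => q + s • p) (𝓝 0) (𝓝 q) := by
    have : Continuous (fun s : ℝ => q + s • p) := by fun_prop
    simpa using this.tendsto 0
  obtain ⟨s, ⟨hs₁, hs₂⟩, hs₃⟩ := (infinite_of_mem_nhds (0 : ℝ)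
    (hline.eventually (((isOpen_domain A).eventually_mem hq).and
      (eventually_weakRigidityRank_le (G := G) hq)))).exists_notMem_finite hfin
  rw [Set.mem_ofPred_eq, not_lt, hL] at hs₃
  have hle : LinearMap.range (L q + s • L p) ≤ trivialMotions G (q + s • p) := by
    rintro _ ⟨⟨⟨t, J, c⟩, hJ, hc⟩, rfl⟩
    -- The velocity is linear in the configuration except for the translation term, which the pencil
    -- multiplies by `1 + s`.
    refine ⟨(t + s • t, J, c), ⟨hJ, hc⟩, funext fun i => ?_⟩
    simp [L, trivialVelocity, smul_comm c s]
    abel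
  have h₁ := Submodule.finrank_mono hle
  have h₂ := Submodule.finrank_mono (trivialMotions_le_ker (G := G) hs₁)
  have h₃ := Submodule.finrank_mono (fun v hv => mem_trivialMotions.2 (h v hv) :
    LinearMap.ker (weakRigidityMatrix G A p).toLinearMap ≤ trivialMotions G p)
  have h₄ := weakRigidityRank_add_finrank_ker (G := G) (A := A) p
  have h₅ := weakRigidityRank_add_finrank_ker (G := G) (A := A) (q + s • p)
  omega

/-- Subtracting the scaling field `c • p` leaves a field that preserves all distances to first
order. -/
theorem isTrivialMotion_of_inner_eq (hspan : affineSpan ℝ (Set.range p) = ⊤) {v : Config n d}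
    {c : ℝ} (hc : G.edgeSet ≠ ∅ → c = 0)
    (h : ∀ i j, inner ℝ (p i - p j) (v i - v j) = c * ‖p i - p j‖ ^ 2) :
    IsTrivialMotion G p v := by
  obtain ⟨t, J, hJ, hv⟩ := exists_skew_of_inner_sub_eq_zero (v := v - c • p) hspan fun i j => by
    have h₁ : (v - c • p) i - (v - c • p) j = (v i - v j) - c • (p i - p j) := by
      simp only [Pi.sub_apply, Pi.smul_apply, smul_sub]
      abel
    rw [h₁, inner_sub_right, h, inner_smul_right, real_inner_self_eq_norm_sq, sub_self]
  exact ⟨t, J, c, hJ, hc, fun i => sub_eq_iff_eq_add.1 (hv i)⟩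

theorem isGIWR_of_isRegularPoint_of_isGWR (hspan : affineSpan ℝ (Set.range p) = ⊤)
    (hreg : IsRegularPoint G A p) (hG : IsGWR G A p) : IsGIWR G A p := by
  intro v hv
  have := Fintype.ofFinite G.edgeSet
  have hdom := (isOpen_domain A).eventually_mem hreg.1
  obtain ⟨γ, hγ0, hγ', hFγ⟩ := (contDiffAt_weakRigidityFunction G hreg.1).exists_curve_in_fiber
    (hdom.mono fun q hq => hreg.2.2 ⟨q, hq, rfl⟩) hv
  have hγt : Tendsto γ (𝓝 0) (𝓝 p) := hγ0 ▸ hγ'.continuousAt.tendsto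
  have hdist (i j : Fin n) : HasDerivAt (fun s => ‖γ s i - γ s j‖ ^ 2)
      (2 * inner ℝ (p i - p j) (v i - v j)) 0 := by
    have h₁ := hasDerivAt_pi.1 hγ'
    have h₂ := ((h₁ i).sub (h₁ j)).norm_sq
    simpa [hγ0] using h₂
  by_cases hE : G.edgeSet = ∅
  · obtain ⟨B, hB, hGB⟩ := hG.2 hE
    -- The factor `C` depends on `s` with no known regularity; cross-multiplying two pairs
    -- eliminates it before differentiating.
    have hprop (i j k l : Fin n) : inner ℝ (p i - p j) (v i - v j) * ‖p k - p l‖ ^ 2 =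
        inner ℝ (p k - p l) (v k - v l) * ‖p i - p j‖ ^ 2 := by
      have h₁ : (fun s => ‖γ s i - γ s j‖ ^ 2 * ‖p k - p l‖ ^ 2) =ᶠ[𝓝 0]
          fun s => ‖γ s k - γ s l‖ ^ 2 * ‖p i - p j‖ ^ 2 := by
        filter_upwards [hFγ, hγt.eventually hB, hγt.eventually hdom] with s h₁ h₂ h₃
        obtain ⟨C, -, hC⟩ := hGB _ h₂ h₃ (weakRigidityFunction_eq_iff.1 h₁).2
        rw [hC, hC]
        ring
      have h₂ := ((hdist i j).mul_const (‖p k - p l‖ ^ 2)).unique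
        (((hdist k l).mul_const (‖p i - p j‖ ^ 2)).congr_of_eventuallyEq h₁)
      linarith
    by_cases hpt : ∃ k l, p k ≠ p l
    · obtain ⟨k, l, hkl⟩ := hpt
      have hne : ‖p k - p l‖ ^ 2 ≠ 0 := pow_ne_zero 2 (norm_ne_zero_iff.2 (sub_ne_zero.2 hkl))
      -- The scaling rate is read off from one pair of distinct points; by `hprop` every pair has
      -- the same rate.
      refine isTrivialMotion_of_inner_eq hspan
        (c := inner ℝ (p k - p l) (v k - v l) / ‖p k - p l‖ ^ 2) (fun h => (h hE).elim)
        fun i j => ?_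
      rw [div_mul_eq_mul_div, eq_div_iff hne, hprop]
    · push Not at hpt
      exact isTrivialMotion_of_inner_eq hspan (c := 0) (fun _ => rfl)
        fun i j => by simp [hpt i j]
  · obtain ⟨B, hB, hGB⟩ := hG.1 hE
    refine isTrivialMotion_of_inner_eq hspan (c := 0) (fun _ => rfl) fun i j => ?_
    have h₁ : (fun s => ‖γ s i - γ s j‖ ^ 2) =ᶠ[𝓝 0] fun _ => ‖p i - p j‖ ^ 2 := by
      filter_upwards [hFγ, hγt.eventually hB, hγt.eventually hdom] with s h₁ h₂ h₃
      rw [hGB _ h₂ h₃ (weakRigidityFunction_eq_iff.1 h₁) i j]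
    have h₂ := (hdist i j).unique ((hasDerivAt_const _ _).congr_of_eventuallyEq h₁)
    linarith

end WeakRigidity

end

theorem mainTheorem4 {n d : ℕ} (G : SimpleGraph (Fin n)) (A : WeakRigidity.AngleSet n)
    (p : WeakRigidity.Config n d) (hp : p ∈ WeakRigidity.domain A)
    (hspan : affineSpan ℝ (Set.range p) = ⊤) :
    WeakRigidity.IsGIWR G A p ↔
      WeakRigidity.IsRegularPoint G A p ∧ WeakRigidity.IsGWR G A p :=
  ⟨fun h => ⟨h.isRegularPoint hp, h.isGWR hp⟩,
    fun h => WeakRigidity.isGIWR_of_isRegularPoint_of_isGWR hspan h.1 h.2⟩
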